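/- Let $T$ be a finite tree with vertex set $V$, $|V|\ge 2$, and let $b\ge 1$ be an integer. In the $(b:1)$ game on $T$, the players Staller and Dominator alternately claim free (not yet claimed) vertices of $T$: in each turn Dominator claims up to $b$ vertices and Staller claims up to one vertex. Dominator wins the $b$-biased Maker--Breaker domination game on $T$ if at some point the vertices that she has claimed form a dominating set of $T$. A leaf of a forest is a vertex of degree $1$, and $L(F)$ is the set of leaves of a forest $F$. $N(v)$ is the set of neighbours of $v$ in $T$, and $N[A]=A\cup\bigcup_{a\in A}N(a)$ for $A\subseteq V$. The tree $T$ is called $b$-good if one can, starting from $T$, recursively delete a vertex that has exactly $b$ leaf neighbours in the current forest, together with these leaf neighbours, until a forest is reached in which every vertex has at most $b-1$ leaf neighbours. For $A\subseteq V$ and a sequence $\mathbf v=(v_1,\dots,v_t)$, $t\ge 0$, of distinct vertices of $V\setminus A$ put $F_0=T$, $F_i=F_{i-1}-\bigl(\{v_i\}\cup((N(v_i)\cap L(F_{i-1}))\setminus A)\bigr)$ for $1\le i\le t$. The sequence $\mathbf v$ is $(A,b)$-admissible if $|(N(v_i)\cap L(F_{i-1}))\setminus A|=b$ for all $1\le i\le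 t$. The tree $T$ is $(A,b)$-good if there are no $(A,b)$-admissible sequence $\mathbf v$ and vertex $u\in V\setminus(A\cup\{v_1,\dots,v_t\})$ with $|(N(u)\cap L(F_t))\setminus A|\ge b+1$. Then the following hold. 1. Dominator has a winning strategy in the $b$-biased Maker--Breaker domination game on $T$ with Staller moving first if and only if $T$ is $b$-good. 2. For every $A\subseteq V$: if the vertices of $A$ are already claimed by Dominator, all other vertices are free, and Staller moves first, then Dominator has a strategy to dominate all vertices of $V\setminus N[A]$ in the $(b:1)$ game on $T$ by claiming vertices of $V\setminus A$ only, if and only if $T$ is $(A,b)$-good. -/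

import Mathlib

open scoped Finset

namespace MBDomination

section Game

variable {V : Type*} [DecidableEq V]

/-- The two players. -/
inductive Player where
  | dominator
  | staller

/-- `W` is dominated by `D`: each vertex of `W` belongs to `D` or has a neighbour in `D`,
that is, `W ⊆ N[D]`. -/
def Dominates (G : SimpleGraph V) (D W : Finset V) : Prop :=
  ∀ w ∈ W, w ∈ D ∨ ∃ d ∈ D, G.Adj d w

/-- `DominatorWins G b W p D S`: in the `(b : 1)` game on the vertices of `G`, from the position
in which Dominator has claimed `D`, Staller has claimed `S` and player `p` moves next, Dominator
has a strategy that makes her set dominate `W` after finitely many moves. In one turn Dominator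
claims up to `b` free vertices and Staller claims up to one free vertex. -/
inductive DominatorWins (G : SimpleGraph V) (b : ℕ) (W : Finset V) :
    Player → Finset V → Finset V → Prop
  | won {p : Player} {D S : Finset V} (h : Dominates G D W) : DominatorWins G b W p D S
  | dominatorMove {D S : Finset V} (M : Finset V) (hcard : #M ≤ b) (hfree : Disjoint M (D ∪ S))
      (h : DominatorWins G b W Player.staller (D ∪ M) S) :
      DominatorWins G b W Player.dominator D S
  | stallerMove {D S : Finset V}
      (h : ∀ M : Finset V, #M ≤ 1 → Disjoint M (D ∪ S) →
        DominatorWins G b W Player.dominator D (S ∪ M)) :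
      DominatorWins G b W Player.staller D S

/-- Dominator wins the `b`-biased Maker-Breaker domination game on `G` when Staller is the first
player: from the empty position she can claim all vertices of a dominating set of `G`. -/
def DominatorWinsStallerFirst [Fintype V] (G : SimpleGraph V) (b : ℕ) : Prop :=
  DominatorWins G b Finset.univ Player.staller ∅ ∅

/-- The closed neighbourhood `N[A]`. -/
def closedNbhd [Fintype V] (G : SimpleGraph V) [DecidableRel G.Adj] (A : Finset V) : Finset V :=
  {w | w ∈ A ∨ ∃ a ∈ A, G.Adj a w}

/-- The vertices of `A` being already claimed by Dominator and Staller moving first, Dominator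
can dominate all vertices of `V ∖ N[A]` in the `(b : 1)` game on `G`. All later moves are made on
free vertices, in particular outside `A`. -/
def DominatorWinsStallerFirstFrom [Fintype V] (G : SimpleGraph V) [DecidableRel G.Adj]
    (A : Finset V) (b : ℕ) : Prop :=
  DominatorWins G b (closedNbhd G A)ᶜ Player.staller A ∅

end Game

section Good

variable {V : Type*} [DecidableEq V] (G : SimpleGraph V) [DecidableRel G.Adj]

/-- The leaves (vertices of degree one) of the subgraph of `G` induced on `F`. -/
def leaves (F : Finset V) : Finset V :=
  {v ∈ F | #{w ∈ F | G.Adj v w} = 1}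

/-- `(N(v) ∩ L(F)) ∖ A`, where `F` stands for the subgraph of `G` induced on `F`. -/
def leafNbrs (A F : Finset V) (v : V) : Finset V :=
  {w ∈ leaves G F | G.Adj v w} \ A

/-- From the induced subgraph on `F`, delete `v` and its leaf neighbours outside `A`. -/
def deleteStar (A F : Finset V) (v : V) : Finset V :=
  F \ ({v} ∪ leafNbrs G A F v)

/-- One can recursively delete from the forest induced on `F` a vertex with exactly `b` leaf
neighbours together with these leaf neighbours, until a forest is reached in which each vertex has
at most `b - 1` leaf neighbours. -/
inductive Reducible (b : ℕ) : Finset V → Prop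
  | finished {F : Finset V} (h : ∀ v ∈ F, #(leafNbrs G ∅ F v) < b) : Reducible b F
  | delete {F : Finset V} (v : V) (hv : v ∈ F) (hb : #(leafNbrs G ∅ F v) = b)
      (h : Reducible b (deleteStar G ∅ F v)) : Reducible b F

variable [Fintype V]

/-- `b`-good trees. -/
def IsGood (b : ℕ) : Prop := Reducible G b Finset.univ

/-- The vertex set of the forest left after the stars at the members of the sequence `l` have
been deleted one after the other. -/
def remaining (A : Finset V) (l : List V) : Finset V :=
  l.foldl (deleteStar G A) Finset.univ

/-- `l` is a sequence of distinct vertices outside `A`, each of which has exactly `b` leaf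
neighbours outside `A` in the forest left by its predecessors. -/
def IsAdmissible (A : Finset V) (b : ℕ) (l : List V) : Prop :=
  l.Nodup ∧ (∀ v ∈ l, v ∉ A) ∧
    ∀ (i : ℕ) (hi : i < l.length), #(leafNbrs G A (remaining G A (l.take i)) l[i]) = b

/-- The sequence `(l | u)` of distinct vertices outside `A` is `(A, b)`-problematic. -/
def IsProblematic (A : Finset V) (b : ℕ) (l : List V) (u : V) : Prop :=
  (l ++ [u]).Nodup ∧ u ∉ A ∧ IsAdmissible G A b l ∧
    b + 1 ≤ #(leafNbrs G A (remaining G A l) u)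

/-- `(A, b)`-good trees. -/
def IsGoodFrom (A : Finset V) (b : ℕ) : Prop :=
  ∀ (l : List V) (u : V), ¬ IsProblematic G A b l u

end Good

end MBDomination

/-! The link between the game and goodness is a family of pairwise disjoint stars with at most `b`
leaves each, lying outside `A` and covering `V ∖ N[A]`. Such a family lets Dominator answer inside
the star just attacked (`dominatorWins_of_stars`). Goodness yields the family: every deleted vertex
with its exactly `b` leaf neighbours is one star, and a forest whose vertices outside `A` have fewer
than `b` leaf neighbours outside `A` is handled by `hasStarCover_of_forest`, working up from the
deepest leaves. Conversely, along a problematic sequence Staller claims `v₁, v₂, …`; each move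
threatens `b` leaves at once and so dictates Dominator's whole reply, until `u` threatens more
leaves than she can claim (`StallerPosition.not_dominatorWins`). For `A = ∅` the circle closes: a
win makes every admissible sequence harmless, a maximal one is a reduction, and any one reduction
gives the stars. -/

namespace MBDomination

/-! ### Disjoint stars and Dominator's strategy -/

section Stars

variable {V : Type*} [DecidableEq V]

/-- A star: a centre together with a nonempty set of at most `b` of its neighbours. -/
structure IsStar (G : SimpleGraph V) (b : ℕ) (s : V × Finset V) : Prop where
  nonempty : s.2.Nonempty
  card_le : #s.2 ≤ b
  adj : ∀ w ∈ s.2, G.Adj s.1 w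

/-- The vertices of a star. -/
def starVerts (s : V × Finset V) : Finset V := insert s.1 s.2

/-- There are pairwise disjoint stars inside `F` that cover `W`. -/
def HasStarCover (G : SimpleGraph V) (b : ℕ) (F W : Finset V) : Prop :=
  ∃ C : Finset (V × Finset V), (∀ s ∈ C, ∀ t ∈ C, s ≠ t → Disjoint (starVerts s) (starVerts t)) ∧
    (∀ s ∈ C, IsStar G b s ∧ starVerts s ⊆ F) ∧ ∀ w ∈ W, ∃ s ∈ C, w ∈ starVerts s

theorem hasStarCover_empty (G : SimpleGraph V) (b : ℕ) (F : Finset V) : HasStarCover G b F ∅ :=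
  ⟨∅, by simp⟩

theorem HasStarCover.insert_star {G : SimpleGraph V} {b : ℕ} {F F' W W' : Finset V}
    (h : HasStarCover G b F' W') {s : V × Finset V} (hs : IsStar G b s)
    (hsF : starVerts s ⊆ F) (hF : F' ⊆ F) (hd : Disjoint (starVerts s) F')
    (hW : ∀ w ∈ W, w ∈ starVerts s ∨ w ∈ W') : HasStarCover G b F W := by
  obtain ⟨C, hC, hC', hcov⟩ := h
  refine ⟨insert s C, ?_, ?_, ?_⟩
  · intro x hx y hy hxy
    rcases Finset.mem_insert.1 hx with hxs | hx' <;> rcases Finset.mem_insert.1 hy with hys | hy'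
    · exact absurd (hxs.trans hys.symm) hxy
    · exact hxs ▸ hd.mono_right (hC' y hy').2
    · exact hys ▸ (hd.mono_right (hC' x hx').2).symm
    · exact hC x hx' y hy' hxy
  · intro x hx
    rcases Finset.mem_insert.1 hx with rfl | hx
    · exact ⟨hs, hsF⟩
    · exact ⟨(hC' x hx).1, (hC' x hx).2.trans hF⟩
  · intro w hw
    rcases hW w hw with hw | hw
    · exact ⟨s, Finset.mem_insert_self _ _, hw⟩
    · obtain ⟨t, ht, hwt⟩ := hcov w hw
      exact ⟨t, Finset.mem_insert_of_mem ht, hwt⟩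

/-- Either some star already contains `w`, or no star uses it and `w` stays available as a leaf of a
further star. -/
theorem HasStarCover.insert_or_erase {G : SimpleGraph V} {b : ℕ} {F W : Finset V}
    (h : HasStarCover G b F W) (w : V) :
    HasStarCover G b F (insert w W) ∨ HasStarCover G b (F.erase w) W := by
  obtain ⟨C, hC, hC', hcov⟩ := h
  by_cases hw : ∃ s ∈ C, w ∈ starVerts s
  · refine .inl ⟨C, hC, hC', fun x hx => ?_⟩
    rcases Finset.mem_insert.1 hx with rfl | hx
    · exact hw
    · exact hcov x hx
  · refine .inr ⟨C, hC, fun s hs => ⟨(hC' s hs).1, fun x hx => ?_⟩, hcov⟩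
    exact Finset.mem_erase.2 ⟨fun e => hw ⟨s, hs, e ▸ hx⟩, (hC' s hs).2 hx⟩

/-- Dominator wins by answering in the star in which Staller has just moved: with all its leaves
if Staller has claimed the centre, and with the centre otherwise. -/
theorem dominatorWins_of_stars (G : SimpleGraph V) (b : ℕ) (hb : 1 ≤ b) (W : Finset V) (n : ℕ) :
    ∀ (C : Finset (V × Finset V)) (D S : Finset V), #C = n →
      (∀ s ∈ C, ∀ t ∈ C, s ≠ t → Disjoint (starVerts s) (starVerts t)) →
      (∀ s ∈ C, IsStar G b s ∧ Disjoint (starVerts s) (D ∪ S)) →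
      (∀ w ∈ W, (w ∈ D ∨ ∃ d ∈ D, G.Adj d w) ∨ ∃ s ∈ C, w ∈ starVerts s) →
      DominatorWins G b W Player.staller D S := by
  induction n with
  | zero =>
    intro C D S hn _ _ hcov
    obtain rfl := Finset.card_eq_zero.1 hn
    exact .won fun w hw => by simpa using hcov w hw
  | succ n ih =>
    intro C D S hn hC hC' hcov
    refine .stallerMove fun M hM hMf => ?_
    -- By disjointness a single vertex meets at most one star; if it meets none, any star serves,
    -- and Dominator secures that one.
    obtain ⟨s, hs, hsM⟩ : ∃ s ∈ C, ∀ t ∈ C, t ≠ s → Disjoint (starVerts t) M := by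
      by_cases h : ∃ s ∈ C, ¬ Disjoint (starVerts s) M
      · obtain ⟨s, hs, hsM⟩ := h
        obtain ⟨x, hx, hxM⟩ := Finset.not_disjoint_iff.1 hsM
        refine ⟨s, hs, fun t ht hts => Finset.disjoint_left.2 fun y hy hyM => ?_⟩
        obtain rfl := Finset.card_le_one.1 hM x hxM y hyM
        exact Finset.disjoint_left.1 (hC t ht s hs hts) hy hx
      · obtain ⟨s, hs⟩ := Finset.card_pos.1 (by omega : 0 < #C)
        exact ⟨s, hs, fun t ht _ => by_contra fun hd => h ⟨t, ht, hd⟩⟩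
    obtain ⟨hstar, hsd⟩ := hC' s hs
    obtain ⟨R, hRs, hRb, hRM, hRdom⟩ : ∃ R ⊆ starVerts s, #R ≤ b ∧ Disjoint R M ∧
        ∀ w ∈ starVerts s, w ∈ R ∨ ∃ d ∈ R, G.Adj d w := by
      by_cases h : s.1 ∈ M
      · refine ⟨s.2, Finset.subset_insert _ _, hstar.card_le, ?_, fun w hw => ?_⟩
        · refine Finset.disjoint_left.2 fun y hy hyM => ?_
          obtain rfl := Finset.card_le_one.1 hM _ h y hyM
          exact G.irrefl (hstar.adj _ hy)
        · rcases Finset.mem_insert.1 hw with rfl | hw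
          · obtain ⟨l, hl⟩ := hstar.nonempty
            exact .inr ⟨l, hl, (hstar.adj l hl).symm⟩
          · exact .inl hw
      · refine ⟨{s.1}, by simp [starVerts], by simpa using hb, by simpa using h, fun w hw => ?_⟩
        rcases Finset.mem_insert.1 hw with rfl | hw
        · simp
        · exact .inr ⟨s.1, by simp, hstar.adj w hw⟩
    refine .dominatorMove R hRb ?_ (ih (C.erase s) _ _ ?_ ?_ ?_ ?_)
    · have := hsd.mono_left hRs
      rw [← Finset.union_assoc, Finset.disjoint_union_right]
      exact ⟨this, hRM⟩
    · rw [Finset.card_erase_of_mem hs, hn]; rfl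
    · exact fun x hx y hy => hC x (Finset.mem_of_mem_erase hx) y (Finset.mem_of_mem_erase hy)
    · intro t ht
      obtain ⟨hts, ht⟩ := Finset.mem_erase.1 ht
      refine ⟨(hC' t ht).1, ?_⟩
      have h1 := (hC' t ht).2
      have h2 := (hC t ht s hs hts).mono_right hRs
      have h3 := hsM t ht hts
      simp only [Finset.disjoint_union_right] at h1 ⊢
      exact ⟨⟨h1.1, h2⟩, h1.2, h3⟩
    · intro w hw
      rcases hcov w hw with (h | ⟨d, hd, hdw⟩) | ⟨t, ht, hwt⟩
      · exact .inl (.inl (Finset.mem_union_left _ h))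
      · exact .inl (.inr ⟨d, Finset.mem_union_left _ hd, hdw⟩)
      · by_cases hts : t = s
        · subst hts
          rcases hRdom w hwt with h | ⟨d, hd, hdw⟩
          · exact .inl (.inl (Finset.mem_union_right _ h))
          · exact .inl (.inr ⟨d, Finset.mem_union_right _ hd, hdw⟩)
        · exact .inr ⟨t, Finset.mem_erase.2 ⟨hts, ht⟩, hwt⟩

theorem HasStarCover.dominatorWins [Fintype V] {G : SimpleGraph V} [DecidableRel G.Adj] {b : ℕ}
    (hb : 1 ≤ b) {A F : Finset V} (hF : Disjoint F A) (h : HasStarCover G b F (closedNbhd G A)ᶜ) :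
    DominatorWinsStallerFirstFrom G A b := by
  obtain ⟨C, hC, hC', hcov⟩ := h
  refine dominatorWins_of_stars G b hb _ _ C A ∅ rfl hC (fun s hs => ⟨(hC' s hs).1, ?_⟩)
    fun w hw => .inr (hcov w hw)
  rw [Finset.union_empty]
  exact hF.mono_left (hC' s hs).2

end Stars

/-! ### Star covers of forests with few leaves at each vertex -/

section Forest

variable {V : Type*}

/-- Uniqueness of the parent in the tree rooted at `r`: shortest paths to `u` and `v` avoid `x`, so
both extend to paths ending at `x`, and these coincide. -/
theorem eq_of_adj_of_dist_lt [DecidableEq V] {G : SimpleGraph V} (hG : G.IsTree) {r u v x : V}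
    (hu : G.Adj u x) (hv : G.Adj v x) (hux : G.dist r u < G.dist r x)
    (hvx : G.dist r v < G.dist r x) : u = v := by
  obtain ⟨p, hp, hp'⟩ := (hG.connected r u).exists_path_of_dist
  obtain ⟨q, hq, hq'⟩ := (hG.connected r v).exists_path_of_dist
  have key : ∀ {y : V} (p : G.Walk r y), p.length < G.dist r x → x ∉ p.support := by
    intro y p hlt hx
    have h1 := SimpleGraph.dist_le (p.takeUntil x hx)
    have h2 := p.length_takeUntil_le_length hx
    omega
  have hp2 := hp.concat (key p (by omega)) hu
  have hq2 := hq.concat (key q (by omega)) hv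
  have := congrArg SimpleGraph.Walk.penultimate ((hG.existsUnique_path r x).unique hp2 hq2)
  simpa using this

variable (G : SimpleGraph V) [DecidableRel G.Adj]

/-- The neighbours of `v` in `F`. -/
def nbrs (F : Finset V) (v : V) : Finset V := {w ∈ F | G.Adj v w}

variable {G}

@[simp] theorem mem_nbrs {F : Finset V} {v w : V} : w ∈ nbrs G F v ↔ w ∈ F ∧ G.Adj v w := by
  simp [nbrs]

/-- A forest with an edge has a vertex with a leaf neighbour all of whose other neighbours,
except for at most one, are leaves as well. -/
theorem exists_penultimate [DecidableEq V] (hG : G.IsTree) {F : Finset V} (hF : ∃ x ∈ F, (nbrs G F x).Nonempty) :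
    ∃ v ∈ F, ∃ x ∈ F, nbrs G F x = {v} ∧
      ∃ w, ∀ y ∈ F, G.Adj v y → y = w ∨ nbrs G F y = {v} := by
  have ⟨r, _, _⟩ := hF
  -- Take a non-isolated vertex of `F` deepest below an arbitrary root `r`; its parent is the
  -- required `v`, and the exceptional neighbour is the parent of `v`.
  obtain ⟨x, hx, hmax⟩ := ({x ∈ F | (nbrs G F x).Nonempty} : Finset V).exists_max_image
    (G.dist r) (by obtain ⟨x, hx, h⟩ := hF; exact ⟨x, by simp [hx, h]⟩)
  simp only [Finset.mem_filter, and_imp] at hx hmax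
  obtain ⟨hxF, v, hv⟩ := hx
  have hvx := mem_nbrs.1 hv
  have hup : ∀ y ∈ F, G.dist r y = G.dist r x → ∀ z ∈ F, G.Adj y z →
      G.dist r y = G.dist r z + 1 := by
    intro y hy hyx z hz hyz
    have := hmax z hz ⟨y, mem_nbrs.2 ⟨hy, hyz.symm⟩⟩
    have := hG.dist_eq_dist_add_one_of_adj r hyz
    omega
  have hleaf : ∀ y ∈ F, G.dist r y = G.dist r x → G.Adj v y → nbrs G F y = {v} := by
    intro y hy hyx hvy
    ext z
    simp only [mem_nbrs, Finset.mem_singleton]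
    refine ⟨fun ⟨hz, hyz⟩ => ?_, fun e => e ▸ ⟨hvx.1, hvy.symm⟩⟩
    have h1 := hup y hy hyx z hz hyz
    have h2 := hup y hy hyx v hvx.1 hvy.symm
    exact eq_of_adj_of_dist_lt (r := r) hG hyz.symm hvy (by omega) (by omega)
  refine ⟨v, hvx.1, x, hxF, hleaf x hxF rfl hvx.2.symm, ?_⟩
  have hd := hup x hxF rfl v hvx.1 hvx.2
  by_cases hw : ∃ w ∈ F, G.Adj v w ∧ G.dist r w < G.dist r v
  · obtain ⟨w, hw, hvw, hlt⟩ := hw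
    refine ⟨w, fun y hy hvy => ?_⟩
    rcases hG.dist_eq_dist_add_one_of_adj r hvy with h | h
    · exact .inl (eq_of_adj_of_dist_lt (r := r) hG hvy.symm hvw.symm (by omega) hlt)
    · exact .inr (hleaf y hy (by omega) hvy)
  · refine ⟨v, fun y hy hvy => .inr (hleaf y hy ?_ hvy)⟩
    rcases hG.dist_eq_dist_add_one_of_adj r hvy with h | h
    · exact absurd ⟨y, hy, hvy, by omega⟩ hw
    · omega

/-- Stars covering `W` exist in a forest without isolated vertices in `W` in which each vertex
has fewer than `b` leaf neighbours in `W`. -/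
theorem hasStarCover_of_forest [DecidableEq V] (hG : G.IsTree) {b : ℕ} (hb : 1 ≤ b) (n : ℕ) :
    ∀ F W : Finset V, #F ≤ n → W ⊆ F → (∀ w ∈ W, (nbrs G F w).Nonempty) →
      (∀ v ∈ F, #{w ∈ W | G.Adj v w ∧ #(nbrs G F w) = 1} < b) → HasStarCover G b F W := by
  induction n with
  | zero =>
    intro F W hn hWF _ _
    obtain rfl := Finset.card_eq_zero.1 (Nat.le_zero.1 hn)
    obtain rfl := Finset.subset_empty.1 hWF
    exact hasStarCover_empty _ _ _
  | succ n ih =>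
    intro F W hn hWF hne hlt
    by_cases hF : ∃ x ∈ F, (nbrs G F x).Nonempty
    swap
    · obtain rfl : W = ∅ := Finset.eq_empty_of_forall_notMem fun w hw =>
        hF ⟨w, hWF hw, hne w hw⟩
      exact hasStarCover_empty _ _ _
    obtain ⟨v, hv, x, hx, hxv, w₀, hw₀⟩ := exists_penultimate hG hF
    have hvx : G.Adj v x := by
      have : v ∈ nbrs G F x := by simp [hxv]
      exact (mem_nbrs.1 this).2.symm
    set K : Finset V := {y ∈ F | nbrs G F y = {v}} with hK
    have hKadj : ∀ y ∈ K, y ∈ F ∧ G.Adj v y ∧ nbrs G F y = {v} := by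
      intro y hy
      obtain ⟨hy, hyv⟩ := Finset.mem_filter.1 hy
      have : v ∈ nbrs G F y := by simp [hyv]
      exact ⟨hy, (mem_nbrs.1 this).2.symm, hyv⟩
    set L : Finset V := K ∩ W with hL
    have hLb : #L < b := by
      refine lt_of_le_of_lt (Finset.card_le_card fun y hy => ?_) (hlt v hv)
      obtain ⟨hyK, hyW⟩ := Finset.mem_inter.1 hy
      obtain ⟨_, h1, h2⟩ := hKadj y hyK
      simp [hyW, h1, h2]
    set F' : Finset V := F \ insert v K with hF'
    have hF'F : F' ⊆ F := Finset.sdiff_subset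
    have hmemF' : ∀ y, y ∈ F' ↔ y ∈ F ∧ y ≠ v ∧ y ∉ K := by simp [hF']
    -- Neighbours of `v` are dropped since they lose `v` and might become isolated or leaves; all
    -- others keep their neighbourhoods, so the hypotheses survive. Only `w₀` can be lost this way.
    set W' : Finset V := {w ∈ W | w ∈ F' ∧ ¬ G.Adj v w} with hW'
    have hnb : ∀ w ∈ W', nbrs G F' w = nbrs G F w := by
      intro w hw
      obtain ⟨hwW, hwF, hvw⟩ := Finset.mem_filter.1 hw
      ext z
      simp only [mem_nbrs, hmemF']
      refine ⟨fun ⟨h1, h2⟩ => ⟨h1.1, h2⟩, fun ⟨h1, h2⟩ => ⟨⟨h1, ?_, fun hz => ?_⟩, h2⟩⟩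
      · rintro rfl; exact hvw h2.symm
      · have : w ∈ nbrs G F z := mem_nbrs.2 ⟨hF'F hwF, h2.symm⟩
        rw [(hKadj z hz).2.2, Finset.mem_singleton] at this
        exact ((hmemF' w).1 hwF).2.1 this
    have hcov : HasStarCover G b F' W' := by
      refine ih F' W' ?_ ?_ ?_ ?_
      · have : #F' < #F := Finset.card_lt_card
          (Finset.ssubset_iff_subset_ne.2 ⟨hF'F, fun e => ((hmemF' v).1 (e ▸ hv)).2.1 rfl⟩)
        omega
      · exact fun w hw => (Finset.mem_filter.1 hw).2.1
      · intro w hw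
        rw [hnb w hw]
        exact hne w (Finset.mem_filter.1 hw).1
      · intro u hu
        refine lt_of_le_of_lt (Finset.card_le_card fun w hw => ?_) (hlt u (hF'F hu))
        obtain ⟨hw, h1, h2⟩ := Finset.mem_filter.1 hw
        rw [hnb w hw] at h2
        exact Finset.mem_filter.2 ⟨(Finset.mem_filter.1 hw).1, h1, h2⟩
    have hcase : ∀ w ∈ W, w ∈ starVerts (v, L) ∨ w ∈ insert w₀ W' := by
      intro w hw
      simp only [starVerts, Finset.mem_insert]
      by_cases h1 : w = v
      · exact .inl (.inl h1)
      by_cases h2 : w ∈ K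
      · exact .inl (.inr (Finset.mem_inter.2 ⟨h2, hw⟩))
      by_cases h3 : G.Adj v w
      · refine .inr (.inl ((hw₀ w (hWF hw) h3).resolve_right fun h => h2 ?_))
        exact Finset.mem_filter.2 ⟨hWF hw, h⟩
      · exact .inr (.inr (Finset.mem_filter.2 ⟨hw, (hmemF' w).2 ⟨hWF hw, h1, h2⟩, h3⟩))
    have hLF : ∀ y ∈ L, y ∈ F ∧ G.Adj v y ∧ y ∈ K := fun y hy =>
      ⟨(hKadj y (Finset.mem_inter.1 hy).1).1, (hKadj y (Finset.mem_inter.1 hy).1).2.1,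
        (Finset.mem_inter.1 hy).1⟩
    have hplain : ∀ {U : Finset V}, HasStarCover G b F' U →
        (∀ w ∈ W, w ∈ starVerts (v, L) ∨ w ∈ U) → HasStarCover G b F W := by
      intro U hU hWU
      have hxK : x ∈ K := Finset.mem_filter.2 ⟨hx, hxv⟩
      -- A star needs a leaf, so `x` is used when no leaf at `v` lies in `W`.
      obtain ⟨L', hLL', hL'ne, hL'b, hL'K⟩ : ∃ L', L ⊆ L' ∧ L'.Nonempty ∧ #L' ≤ b ∧ L' ⊆ K := by
        by_cases hLe : L.Nonempty
        · exact ⟨L, subset_rfl, hLe, hLb.le, Finset.inter_subset_left⟩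
        · rw [Finset.not_nonempty_iff_eq_empty] at hLe
          exact ⟨{x}, by simp [hLe], by simp, by simpa using hb, by simpa using hxK⟩
      refine hU.insert_star (s := (v, L')) ⟨hL'ne, hL'b, fun y hy => (hKadj y (hL'K hy)).2.1⟩
        ?_ hF'F ?_ fun w hw => ?_
      · exact Finset.insert_subset hv fun y hy => (hKadj y (hL'K hy)).1
      · exact Finset.disjoint_sdiff.mono_left (Finset.insert_subset_insert _ hL'K)
      · exact (hWU w hw).imp_left fun h => Finset.insert_subset_insert _ hLL' h
    -- If the smaller cover leaves `w₀` unused, it can join the star at `v`: the strict bound `#L <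
    -- b` reserves exactly this one place.
    rcases hcov.insert_or_erase w₀ with h | h
    · exact hplain h hcase
    · by_cases hw : w₀ ∈ F' ∧ G.Adj v w₀
      · refine h.insert_star (s := (v, insert w₀ L)) ⟨by simp, ?_, fun y hy => ?_⟩ ?_
          ((Finset.erase_subset _ _).trans hF'F) ?_ fun w hw => ?_
        · exact (Finset.card_insert_le _ _).trans hLb
        · rcases Finset.mem_insert.1 hy with rfl | hy
          · exact hw.2
          · exact (hLF y hy).2.1
        · exact Finset.insert_subset hv (Finset.insert_subset (hF'F hw.1) fun y hy => (hLF y hy).1)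
        · refine Finset.disjoint_left.2 fun y hy hyF => ?_
          obtain ⟨hyw, hyF⟩ := Finset.mem_erase.1 hyF
          obtain ⟨-, h1, h2⟩ := (hmemF' y).1 hyF
          simp only [starVerts, Finset.mem_insert] at hy
          exact hy.elim h1 fun h => h.elim hyw fun h => h2 (hLF y h).2.2
        · have := hcase w hw
          simp only [starVerts, Finset.mem_insert] at this ⊢
          tauto
      · refine hplain hcov fun w hwW => ?_
        rcases hcase w hwW with h' | h'
        · exact .inl h'
        · rcases Finset.mem_insert.1 h' with rfl | h'
          · by_cases h1 : w = v
            · simp [starVerts, h1]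
            by_cases h2 : w ∈ K
            · simp [starVerts, hL, h2, hwW]
            have h3 : w ∈ F' := (hmemF' w).2 ⟨hWF hwW, h1, h2⟩
            exact .inr (Finset.mem_filter.2 ⟨hwW, h3, fun h4 => hw ⟨h3, h4⟩⟩)
          · exact .inr h'

end Forest
-- From goodness to star covers
section Reduction

variable {V : Type*} [DecidableEq V] {G : SimpleGraph V} [DecidableRel G.Adj]

theorem mem_leafNbrs {A F : Finset V} {v w : V} :
    w ∈ leafNbrs G A F v ↔ w ∈ F ∧ #(nbrs G F w) = 1 ∧ G.Adj v w ∧ w ∉ A := by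
  simp [leafNbrs, leaves, nbrs, and_assoc]

theorem mem_deleteStar {A F : Finset V} {v w : V} :
    w ∈ deleteStar G A F v ↔ w ∈ F ∧ w ≠ v ∧ w ∉ leafNbrs G A F v := by
  simp [deleteStar]

theorem eq_of_adj_leafNbr {A F : Finset V} {v w z : V} (hv : v ∈ F)
    (hw : w ∈ leafNbrs G A F v) (hz : z ∈ F) (hwz : G.Adj w z) : z = v := by
  obtain ⟨_, h1, hvw, _⟩ := mem_leafNbrs.1 hw
  exact Finset.card_le_one.1 h1.le z (mem_nbrs.2 ⟨hz, hwz⟩) v (mem_nbrs.2 ⟨hv, hvw.symm⟩)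

theorem card_deleteStar_lt {A F : Finset V} {v : V} (hv : v ∈ F) :
    #(deleteStar G A F v) < #F :=
  Finset.card_lt_card (Finset.ssubset_iff_subset_ne.2
    ⟨Finset.sdiff_subset, fun e => (mem_deleteStar.1 (e ▸ hv)).2.1 rfl⟩)

variable [Fintype V]

theorem mem_closedNbhd {A : Finset V} {w : V} :
    w ∈ closedNbhd G A ↔ w ∈ A ∨ ∃ a ∈ A, G.Adj a w := by
  simp [closedNbhd]

/-- No vertex outside `N[A]` is isolated in `F`. -/
def NoIsolated (G : SimpleGraph V) [DecidableRel G.Adj] (A F : Finset V) : Prop :=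
  ∀ w ∈ F, w ∉ closedNbhd G A → (nbrs G F w).Nonempty

theorem noIsolated_univ (hG : G.IsTree) (hV : 2 ≤ Fintype.card V) (A : Finset V) :
    NoIsolated G A Finset.univ := by
  intro w _ _
  have : Nontrivial V := Fintype.one_lt_card_iff_nontrivial.1 hV
  obtain ⟨z, hz⟩ := hG.connected.preconnected.exists_adj_of_nontrivial w
  exact ⟨z, mem_nbrs.2 ⟨Finset.mem_univ _, hz⟩⟩

/-- The deleted leaves have no neighbour but `v`, so a surviving vertex can lose only `v`. If that
was its only neighbour, it was a leaf neighbour of `v` and would have been deleted too. -/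
theorem NoIsolated.deleteStar {A F : Finset V} (h : NoIsolated G A F) {v : V} (hv : v ∈ F) :
    NoIsolated G A (deleteStar G A F v) := by
  intro w hw hwA
  obtain ⟨hwF, hwv, hwl⟩ := mem_deleteStar.1 hw
  by_contra hne
  have hall : ∀ z ∈ nbrs G F w, z = v := by
    intro z hz
    by_contra hzv
    obtain ⟨hzF, hwz⟩ := mem_nbrs.1 hz
    refine hne ⟨z, mem_nbrs.2 ⟨mem_deleteStar.2 ⟨hzF, hzv, fun hzl => hwv ?_⟩, hwz⟩⟩
    exact eq_of_adj_leafNbr hv hzl hwF hwz.symm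
  obtain ⟨z, hz⟩ := h w hwF hwA
  have hzv := hall z hz
  subst hzv
  refine hwl (mem_leafNbrs.2 ⟨hwF, ?_, (mem_nbrs.1 hz).2.symm, fun h => ?_⟩)
  · exact Finset.card_eq_one.2 ⟨z, Finset.eq_singleton_iff_unique_mem.2 ⟨hz, hall⟩⟩
  · exact hwA (mem_closedNbhd.2 (.inl h))

/-- Vertices outside `N[A]` have no neighbour in `A`, so removing `A` leaves their degrees unchanged
and the forest lemma applies to `F \ A`. -/
theorem hasStarCover_of_leafNbrs_lt (hG : G.IsTree) {b : ℕ} (hb : 1 ≤ b) {A F : Finset V}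
    (hF : NoIsolated G A F) (h : ∀ v ∈ F, v ∉ A → #(leafNbrs G A F v) < b) :
    HasStarCover G b (F \ A) (F \ closedNbhd G A) := by
  have hnb : ∀ w ∈ F \ closedNbhd G A, nbrs G (F \ A) w = nbrs G F w := by
    intro w hw
    ext z
    simp only [mem_nbrs, Finset.mem_sdiff]
    refine ⟨fun h => ⟨h.1.1, h.2⟩, fun h => ⟨⟨h.1, fun hz => ?_⟩, h.2⟩⟩
    exact (Finset.mem_sdiff.1 hw).2 (mem_closedNbhd.2 (.inr ⟨z, hz, h.2.symm⟩))
  refine hasStarCover_of_forest hG hb _ _ _ le_rfl ?_ ?_ ?_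
  · exact Finset.sdiff_subset_sdiff subset_rfl fun a ha => mem_closedNbhd.2 (.inl ha)
  · intro w hw
    rw [hnb w hw]
    exact hF w (Finset.mem_sdiff.1 hw).1 (Finset.mem_sdiff.1 hw).2
  · intro v hv
    obtain ⟨hv, hvA⟩ := Finset.mem_sdiff.1 hv
    refine lt_of_le_of_lt (Finset.card_le_card fun w hw => ?_) (h v hv hvA)
    obtain ⟨hw, h1, h2⟩ := Finset.mem_filter.1 hw
    rw [hnb w hw] at h2
    obtain ⟨hw, hwA⟩ := Finset.mem_sdiff.1 hw
    exact mem_leafNbrs.2 ⟨hw, h2, h1, fun h => hwA (mem_closedNbhd.2 (.inl h))⟩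

theorem hasStarCover_of_deleteStar {b : ℕ} (hb : 1 ≤ b) {A F : Finset V} {v : V} (hv : v ∈ F)
    (hvA : v ∉ A) (hvb : #(leafNbrs G A F v) = b)
    (h : HasStarCover G b (deleteStar G A F v \ A) (deleteStar G A F v \ closedNbhd G A)) :
    HasStarCover G b (F \ A) (F \ closedNbhd G A) := by
  refine h.insert_star (s := (v, leafNbrs G A F v))
    ⟨Finset.card_pos.1 (by simp only; omega), hvb.le, fun w hw => (mem_leafNbrs.1 hw).2.2.1⟩
    ?_ (Finset.sdiff_subset_sdiff Finset.sdiff_subset subset_rfl) ?_ fun w hw => ?_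
  · refine Finset.insert_subset (Finset.mem_sdiff.2 ⟨hv, hvA⟩) fun w hw => ?_
    have := mem_leafNbrs.1 hw
    exact Finset.mem_sdiff.2 ⟨this.1, this.2.2.2⟩
  · refine Finset.disjoint_left.2 fun w hw hw' => ?_
    have := mem_deleteStar.1 (Finset.mem_sdiff.1 hw').1
    exact (Finset.mem_insert.1 hw).elim this.2.1 this.2.2
  · obtain ⟨hw, hwA⟩ := Finset.mem_sdiff.1 hw
    by_cases hws : w ∈ starVerts (v, leafNbrs G A F v)
    · exact .inl hws
    · simp only [starVerts, Finset.mem_insert, not_or] at hws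
      exact .inr (Finset.mem_sdiff.2 ⟨mem_deleteStar.2 ⟨hw, hws⟩, hwA⟩)

theorem Reducible.hasStarCover (hG : G.IsTree) {b : ℕ} (hb : 1 ≤ b) {F : Finset V}
    (h : Reducible G b F) (hF : NoIsolated G ∅ F) :
    HasStarCover G b (F \ ∅) (F \ closedNbhd G ∅) := by
  induction h with
  | finished h => exact hasStarCover_of_leafNbrs_lt hG hb hF fun v hv _ => h v hv
  | delete v hv hvb _ ih =>
    exact hasStarCover_of_deleteStar hb hv (by simp) hvb (ih (hF.deleteStar hv))

theorem notMem_remaining_of_mem {A : Finset V} {l : List V} {v : V} (hv : v ∈ l) :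
    v ∉ remaining G A l := by
  induction l using List.reverseRecOn with
  | nil => simp at hv
  | append_singleton l u ih =>
    simp only [remaining, List.foldl_append, List.foldl_cons, List.foldl_nil, mem_deleteStar]
    rintro ⟨h1, h2, -⟩
    rcases List.mem_append.1 hv with h | h
    · exact ih h h1
    · exact h2 (List.mem_singleton.1 h)

theorem remaining_concat (A : Finset V) (l : List V) (v : V) :
    remaining G A (l ++ [v]) = deleteStar G A (remaining G A l) v := by
  simp [remaining]

theorem IsAdmissible.concat {A : Finset V} {b : ℕ} {l : List V} (h : IsAdmissible G A b l) {v : V}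
    (hv : v ∈ remaining G A l) (hvA : v ∉ A) (hvb : #(leafNbrs G A (remaining G A l) v) = b) :
    IsAdmissible G A b (l ++ [v]) := by
  obtain ⟨h1, h2, h3⟩ := h
  refine ⟨?_, ?_, fun i hi => ?_⟩
  · rw [List.nodup_append]
    refine ⟨h1, List.nodup_singleton v, fun x hx y hy e => ?_⟩
    rw [List.mem_singleton.1 hy] at e
    exact notMem_remaining_of_mem (e ▸ hx) hv
  · simpa [or_imp, forall_and, hvA] using h2
  · rw [List.length_append, List.length_singleton] at hi
    rcases Nat.lt_succ_iff_lt_or_eq.1 hi with hi' | rfl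
    · rw [List.take_append_of_le_length hi'.le, List.getElem_append_left hi']
      exact h3 i hi'
    · simpa using hvb

theorem IsGoodFrom.card_leafNbrs_le {A : Finset V} {b : ℕ} (hgood : IsGoodFrom G A b) {l : List V}
    (hl : IsAdmissible G A b l) {v : V} (hv : v ∈ remaining G A l) (hvA : v ∉ A) :
    #(leafNbrs G A (remaining G A l) v) ≤ b := by
  by_contra hlt
  refine hgood l v ⟨?_, hvA, hl, by omega⟩
  rw [List.nodup_append]
  refine ⟨hl.1, List.nodup_singleton v, fun x hx y hy e => ?_⟩
  rw [List.mem_singleton.1 hy] at e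
  exact notMem_remaining_of_mem (e ▸ hx) hv

/-- Induction along maximal admissible sequences. -/
theorem IsGoodFrom.induction {A : Finset V} {b : ℕ} (hgood : IsGoodFrom G A b)
    {P : Finset V → Prop}
    (finish : ∀ l, (∀ v ∈ remaining G A l, v ∉ A → #(leafNbrs G A (remaining G A l) v) < b) →
      P (remaining G A l))
    (step : ∀ F v, v ∈ F → v ∉ A → #(leafNbrs G A F v) = b → P (deleteStar G A F v) → P F) :
    P Finset.univ := by
  suffices h : ∀ (n : ℕ) (l : List V), #(remaining G A l) ≤ n → IsAdmissible G A b l →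
      P (remaining G A l) from h _ [] le_rfl ⟨by simp, by simp, by simp⟩
  intro n
  induction n with
  | zero =>
    intro l hn _
    have := Finset.card_eq_zero.1 (Nat.le_zero.1 hn)
    exact finish l (by simp [this])
  | succ n ih =>
    intro l hn hl
    by_cases h : ∀ v ∈ remaining G A l, v ∉ A → #(leafNbrs G A (remaining G A l) v) < b
    · exact finish l h
    · push Not at h
      obtain ⟨v, hv, hvA, hvb⟩ := h
      -- Goodness excludes more than `b` leaf neighbours, so the count is exact and `v` extends the
      -- sequence.
      have hvb' := le_antisymm (hgood.card_leafNbrs_le hl hv hvA) hvb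
      refine step _ v hv hvA hvb' ?_
      rw [← remaining_concat]
      refine ih _ ?_ (hl.concat hv hvA hvb')
      rw [remaining_concat]
      have := card_deleteStar_lt (G := G) (A := A) hv
      omega

theorem IsGoodFrom.isGood {b : ℕ} (h : IsGoodFrom G ∅ b) : IsGood G b :=
  h.induction (fun _ h => .finished fun v hv => h v hv (by simp))
    fun _ v hv _ hvb h => .delete v hv hvb h

theorem IsGoodFrom.hasStarCover (hG : G.IsTree) (hV : 2 ≤ Fintype.card V) {A : Finset V} {b : ℕ}
    (hb : 1 ≤ b) (h : IsGoodFrom G A b) :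
    HasStarCover G b (Finset.univ \ A) (Finset.univ \ closedNbhd G A) := by
  -- The motive is an implication because absence of isolated vertices passes down to the smaller
  -- forest, while the cover passes back up.
  refine h.induction (P := fun F => NoIsolated G A F →
    HasStarCover G b (F \ A) (F \ closedNbhd G A)) ?_ ?_ (noIsolated_univ hG hV A)
  · exact fun l hl hF => hasStarCover_of_leafNbrs_lt hG hb hF hl
  · exact fun F v hv hvA hvb ih hF => hasStarCover_of_deleteStar hb hv hvA hvb (ih (hF.deleteStar hv))

end Reduction

/-! ### Staller's forcing strategy -/

section Staller

variable {V : Type*} [DecidableEq V] {G : SimpleGraph V} {b : ℕ} {W : Finset V}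

/-- Dominator cannot win once Staller has claimed the closed neighbourhood of a vertex in `W`. -/
theorem not_dominatorWins_of_closed {p : Player} {D S : Finset V} (h : DominatorWins G b W p D S)
    (hd : Disjoint D S) {w : V} (hw : w ∈ W) (hwS : w ∈ S) (hN : ∀ z, G.Adj z w → z ∈ S) :
    False := by
  induction h with
  | won h =>
    rcases h w hw with h | ⟨d, hdD, hdw⟩
    · exact Finset.disjoint_left.1 hd h hwS
    · exact Finset.disjoint_left.1 hd hdD (hN d hdw)
  | dominatorMove M _ hM _ ih =>
    exact ih (Finset.disjoint_union_left.2 ⟨hd, (Finset.disjoint_union_right.1 hM).2⟩) hwS hN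
  | stallerMove _ ih =>
    -- Staller may simply pass.
    exact ih ∅ (by simp) (by simp) (by simpa using hd) (by simpa using hwS) (by simpa using hN)

/-- Dominator has to claim a vertex in `W` all of whose neighbours Staller has claimed. -/
theorem mem_of_dominatorWins {D S : Finset V} (h : DominatorWins G b W Player.staller D S)
    (hd : Disjoint D S) {w : V} (hw : w ∈ W) (hN : ∀ z, G.Adj z w → z ∈ S) : w ∈ D := by
  by_contra hwD
  cases h with
  | won h =>
    rcases h w hw with h | ⟨d, hdD, hdw⟩
    · exact hwD h
    · exact Finset.disjoint_left.1 hd hdD (hN d hdw)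
  | stallerMove h =>
    by_cases hwS : w ∈ S
    · exact not_dominatorWins_of_closed (.stallerMove h) hd hw hwS hN
    · refine not_dominatorWins_of_closed (h {w} (by simp) (by simp [hwD, hwS])) ?_ hw (by simp)
        fun z hz => Finset.mem_union_left _ (hN z hz)
      simpa [hwD] using hd

/-- Any vertex of `L` left unclaimed is taken by Staller next and can never be dominated, so one
reply must contain all of `L`. Nonemptiness of `L` rules out an already won position. -/
theorem exists_reply_of_dominatorWins {D S L : Finset V}
    (h : DominatorWins G b W Player.dominator D S) (hd : Disjoint D S) (hL : L.Nonempty)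
    (hLW : L ⊆ W) (hLD : Disjoint L D) (hN : ∀ w ∈ L, ∀ z, G.Adj z w → z ∈ S) :
    ∃ M, L ⊆ M ∧ #M ≤ b ∧ Disjoint M (D ∪ S) ∧ DominatorWins G b W Player.staller (D ∪ M) S := by
  cases h with
  | won h =>
    obtain ⟨w, hw⟩ := hL
    rcases h w (hLW hw) with h | ⟨d, hdD, hdw⟩
    · exact (Finset.disjoint_left.1 hLD hw h).elim
    · exact (Finset.disjoint_left.1 hd hdD (hN w hw d hdw)).elim
  | dominatorMove M hM hMd h =>
    refine ⟨M, fun w hw => ?_, hM, hMd, h⟩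
    have := mem_of_dominatorWins h
      (Finset.disjoint_union_left.2 ⟨hd, (Finset.disjoint_union_right.1 hMd).2⟩) (hLW hw) (hN w hw)
    exact (Finset.mem_union.1 this).resolve_left (Finset.disjoint_left.1 hLD hw)

variable [DecidableRel G.Adj]

/-- A position in which the free vertices are those of `F ∖ A` and all the deleted neighbours of
vertices of `F` belong to Staller. -/
structure StallerPosition (G : SimpleGraph V) (A F D S : Finset V) : Prop where
  subset : A ⊆ F
  disjoint : Disjoint D S
  free : ∀ w ∈ F, w ∉ A → w ∉ D ∧ w ∉ S
  outside : ∀ w ∈ F, ∀ z, G.Adj w z → z ∈ F ∨ z ∈ S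

/-- Once Staller claims `v`, each leaf neighbour of `v` outside `A` has only Staller's vertices
around it. It lies outside `N[A]`, as its sole neighbour in `F ⊇ A` is `v ∉ A`, so Dominator must
claim it. -/
theorem StallerPosition.force [Fintype V] {A F D S : Finset V} (hpos : StallerPosition G A F D S)
    (h : DominatorWins G b (closedNbhd G A)ᶜ Player.staller D S) {v : V} (hvA : v ∉ A)
    (hvS : v ∉ S) (hL : (leafNbrs G A F v).Nonempty) :
    v ∈ F ∧ ∃ M, leafNbrs G A F v ⊆ M ∧ #M ≤ b ∧ Disjoint M (D ∪ (S ∪ {v})) ∧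
      Disjoint D (S ∪ {v}) ∧
      DominatorWins G b (closedNbhd G A)ᶜ Player.staller (D ∪ M) (S ∪ {v}) := by
  have hv : v ∈ F := by
    obtain ⟨w, hw⟩ := hL
    obtain ⟨hwF, _, hvw, _⟩ := mem_leafNbrs.1 hw
    exact (hpos.outside w hwF v hvw.symm).resolve_right hvS
  have hvD := (hpos.free v hv hvA).1
  have hd : Disjoint D (S ∪ {v}) := by simpa [hvD] using hpos.disjoint
  have hW : leafNbrs G A F v ⊆ (closedNbhd G A)ᶜ := by
    intro w hw
    obtain ⟨hwF, _, hvw, hwA⟩ := mem_leafNbrs.1 hw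
    rw [Finset.mem_compl, mem_closedNbhd]
    rintro (h | ⟨a, ha, haw⟩)
    · exact hwA h
    · exact hvA (eq_of_adj_leafNbr hv hw (hpos.subset ha) haw.symm ▸ ha)
  have hLD : Disjoint (leafNbrs G A F v) D := Finset.disjoint_left.2 fun w hw =>
    (hpos.free w (mem_leafNbrs.1 hw).1 (mem_leafNbrs.1 hw).2.2.2).1
  have hN : ∀ w ∈ leafNbrs G A F v, ∀ z, G.Adj z w → z ∈ S ∪ {v} := by
    intro w hw z hz
    rcases hpos.outside w (mem_leafNbrs.1 hw).1 z hz.symm with h | h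
    · simp [eq_of_adj_leafNbr hv hw h hz.symm]
    · exact Finset.mem_union_left _ h
  have hmove : DominatorWins G b (closedNbhd G A)ᶜ Player.dominator D (S ∪ {v}) := by
    cases h with
    | won h => exact .won h
    | stallerMove h => exact h {v} (by simp) (by simp [hvD, hvS])
  obtain ⟨M, h1, h2, h3, h4⟩ := exists_reply_of_dominatorWins hmove hd hL hW hLD hN
  exact ⟨hv, M, h1, h2, h3, hd, h4⟩

theorem StallerPosition.deleteStar {A F D S : Finset V} (hpos : StallerPosition G A F D S)
    {v : V} (hv : v ∈ F) (hvA : v ∉ A) :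
    StallerPosition G A (deleteStar G A F v) (D ∪ leafNbrs G A F v) (S ∪ {v}) where
  subset a ha := mem_deleteStar.2
    ⟨hpos.subset ha, fun e => hvA (e ▸ ha), fun h => (mem_leafNbrs.1 h).2.2.2 ha⟩
  disjoint := by
    have hvD := (hpos.free v hv hvA).1
    have hL : Disjoint (leafNbrs G A F v) (S ∪ {v}) := by
      refine Finset.disjoint_left.2 fun w hw hw' => ?_
      obtain ⟨hwF, _, hvw, hwA⟩ := mem_leafNbrs.1 hw
      rcases Finset.mem_union.1 hw' with h | h
      · exact (hpos.free w hwF hwA).2 h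
      · exact hvw.ne' (Finset.mem_singleton.1 h)
    exact Finset.disjoint_union_left.2 ⟨by simpa [hvD] using hpos.disjoint, hL⟩
  free w hw hwA := by
    obtain ⟨hwF, hwv, hwl⟩ := mem_deleteStar.1 hw
    have := hpos.free w hwF hwA
    simp [this, hwv, hwl]
  outside w hw z hwz := by
    obtain ⟨hwF, hwv, hwl⟩ := mem_deleteStar.1 hw
    rcases hpos.outside w hwF z hwz with h | h
    · by_cases hzv : z = v
      · simp [hzv]
      · refine .inl (mem_deleteStar.2 ⟨h, hzv, fun hz => hwv ?_⟩)
        exact eq_of_adj_leafNbr hv hz hwF hwz.symm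
    · exact .inr (Finset.mem_union_left _ h)

/-- Staller wins by playing along a problematic sequence. -/
theorem StallerPosition.not_dominatorWins [Fintype V] (hb : 1 ≤ b) {A : Finset V} {u : V} (huA : u ∉ A)
    (l : List V) : ∀ F D S : Finset V, StallerPosition G A F D S → (l ++ [u]).Nodup →
      (∀ v ∈ l ++ [u], v ∉ S) → (∀ v ∈ l, v ∉ A) →
      (∀ (i : ℕ) (hi : i < l.length),
        #(leafNbrs G A ((l.take i).foldl (MBDomination.deleteStar G A) F) l[i]) = b) →
      b + 1 ≤ #(leafNbrs G A (l.foldl (MBDomination.deleteStar G A) F) u) →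
      ¬ DominatorWins G b (closedNbhd G A)ᶜ Player.staller D S := by
  induction l with
  | nil =>
    intro F D S hpos _ hS _ _ hu h
    simp only [List.foldl_nil] at hu
    -- The forced reply would have at least `b + 1` vertices.
    obtain ⟨_, M, h1, h2, _⟩ := hpos.force h huA (hS u (by simp)) (Finset.card_pos.1 (by omega))
    have := Finset.card_le_card h1
    omega
  | cons v l ih =>
    intro F D S hpos hnd hS hA hl hu h
    have hvb : #(leafNbrs G A F v) = b := hl 0 (by simp)
    have hvA := hA v (by simp)
    obtain ⟨hv, M, h1, h2, _, _, h5⟩ :=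
      hpos.force h hvA (hS v (by simp)) (Finset.card_pos.1 (by omega))
    -- The `b` forced leaves exhaust the move, so Dominator gains no extra vertex and the position
    -- keeps its shape.
    obtain rfl := Finset.eq_of_subset_of_card_le h1 (by omega)
    rw [List.cons_append, List.nodup_cons] at hnd
    refine ih _ _ _ (hpos.deleteStar hv hvA) hnd.2 ?_ (fun x hx => hA x (by simp [hx])) ?_ hu h5
    · intro x hx
      have hxv : x ≠ v := fun e => hnd.1 (e ▸ hx)
      have := hS x (by rw [List.cons_append]; exact List.mem_cons_of_mem _ hx)
      simp [hxv, this]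
    · intro i hi
      exact hl (i + 1) (by simpa using hi)

theorem isGoodFrom_of_dominatorWins [Fintype V] (hb : 1 ≤ b) {A : Finset V}
    (h : DominatorWinsStallerFirstFrom G A b) : IsGoodFrom G A b := by
  rintro l u ⟨hnd, huA, ⟨_, hA, hl⟩, hu⟩
  refine StallerPosition.not_dominatorWins hb huA l Finset.univ A ∅ ?_ hnd (by simp) hA hl hu h
  exact ⟨by simp, by simp, by simp, by simp⟩

theorem dominatorWinsStallerFirstFrom_empty [Fintype V] :
    DominatorWinsStallerFirstFrom G ∅ b ↔ DominatorWinsStallerFirst G b := by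
  have : (closedNbhd G ∅)ᶜ = Finset.univ := by ext; simp [mem_closedNbhd]
  simp [DominatorWinsStallerFirstFrom, DominatorWinsStallerFirst, this]

end Staller

end MBDomination

theorem mainTheorem1 {V : Type*} [Fintype V] [DecidableEq V]
    (T : SimpleGraph V) [DecidableRel T.Adj] (hT : T.IsTree) (hV : 2 ≤ Fintype.card V)
    (b : ℕ) (hb : 1 ≤ b) :
    (MBDomination.DominatorWinsStallerFirst T b ↔ MBDomination.IsGood T b) ∧
      ∀ A : Finset V,
        MBDomination.DominatorWinsStallerFirstFrom T A b ↔ MBDomination.IsGoodFrom T A b := by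
  refine ⟨?_, fun A => ⟨MBDomination.isGoodFrom_of_dominatorWins hb, fun h =>
    MBDomination.HasStarCover.dominatorWins hb Finset.sdiff_disjoint (h.hasStarCover hT hV hb)⟩⟩
  rw [← MBDomination.dominatorWinsStallerFirstFrom_empty]
  exact ⟨fun h => (MBDomination.isGoodFrom_of_dominatorWins hb h).isGood, fun h =>
    MBDomination.HasStarCover.dominatorWins hb Finset.sdiff_disjoint
      (MBDomination.Reducible.hasStarCover hT hb h (MBDomination.noIsolated_univ hT hV ∅))⟩
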